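/- For $z\in\mathbb C$ and $n\ge 0$ let $P_n(z)$ denote the coefficient of $q^n$ in the $q$-expansion $$\sum_{n=0}^{\infty}P_n(z)\,q^n=\prod_{k=1}^{\infty}(1-q^k)^{-z}\qquad(q\in\mathbb C,\ |q|<1),$$ with principal powers (as is well known, $P_n$ is a polynomial in $z$; for example $P_0(z)=1$, $P_1(z)=z$, $P_2(z)=z(z+3)/2$). For integers $a\ge 1$, $b\ge 0$ put $$\Delta_{a,b}(x)=P_{a-1}(x)P_{b+1}(x)-P_a(x)P_b(x).$$ Let $b\in\{1,2,3\}$, and put $x_0=1$ if $b$ is odd and $x_0=2$ if $b$ is even. Then $$\Delta_{a,b}(x)>0$$ for all integers $a\ge b+2$ and all real numbers $x>x_0$. -/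

import Mathlib

/-- The function `q ↦ ∏_{k ≥ 1} (1 - q ^ k) ^ (-z)`. For `‖q‖ < 1` each factor is the principal
power of a number in the right half plane, and the product converges absolutely. -/
noncomputable def etaProduct (z q : ℂ) : ℂ :=
  ∏' k : ℕ, (1 - q ^ (k + 1)) ^ (-z)

/-- `P_n(z)`: the coefficient of `q ^ n` in the `q`-expansion (the Taylor expansion at `q = 0`)
of `∏_{k ≥ 1} (1 - q ^ k) ^ (-z)`. -/
noncomputable def etaCoeff (n : ℕ) (z : ℂ) : ℂ :=
  iteratedDeriv n (etaProduct z) 0 / (n.factorial : ℂ)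

/-- `Δ_{a,b}(z) = P_{a-1}(z) P_{b+1}(z) - P_a(z) P_b(z)`, for `a ≥ 1`. -/
noncomputable def etaDelta (a b : ℕ) (z : ℂ) : ℂ :=
  etaCoeff (a - 1) z * etaCoeff (b + 1) z - etaCoeff a z * etaCoeff b z

/-!
The product is `F(q) = exp (z L(q))` with `L(q) = -∑ log (1 - q ^ k)`, and the Lambert expansion
`L'(q) = ∑ σ(n + 1) q ^ n` turns `F' = z L' F` into the recurrence
`n P_n = z ∑_{k=1}^n σ(k) P_{n-k}` (`succ_mul_etaCoeff_succ`). In particular `P_n(x)` is real for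
real `x`, and it is nonnegative for `x ≥ 0`.

Subtracting multiples of two consecutive instances shows that for fixed `b` and `x` the differences
`Δ_n = P_{n-1} P_{b+1} - P_n P_b` (with `P_{-1} = 0`) satisfy
`n Δ_n = P_{n-1} P_{b+1} + x ∑_{j<n} σ(n - j) Δ_j` (`succ_mul_etaDeltaRe_succ`). Since
`Δ_{b+1} = 0`, induction gives `Δ_n > 0` for all `n ≥ b + 2` once the `b + 1` explicit terms with
`j ≤ b`, which are the only ones that can be negative, are outweighed by `P_{n-1} P_{b+1}`
(`etaDeltaRe_pos_of_forall`).

For `b ≤ 3` this is an elementary estimate. As `σ(k) ≥ k`, the coefficient `P_n(x)` is at least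
the coefficient of `q ^ n` in `exp (x q / (1 - q))`, of which the terms up to `x ^ 4` suffice
(`quartic_le_etaCoeffRe`); these grow like `n ^ 3`, while `σ(n) ≤ n (n + 10) / 8`
(`sigma_one_le`). In the variables `y = x - x₀` and `t = n - n₀` the inequality becomes one between
polynomials with nonnegative coefficients. The finitely many smaller `n` are treated in the same
way with the exact values of `σ`.
-/

open Filter Topology
open scoped ArithmeticFunction.sigma

/-! ### The logarithmic derivative and the recurrence for the coefficients -/

/-- The logarithm `-∑_{k ≥ 1} log (1 - q ^ k)` of `∏_{k ≥ 1} (1 - q ^ k)⁻¹`, with principal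
logarithms. -/
noncomputable def etaLog (q : ℂ) : ℂ := ∑' k : ℕ, -Complex.log (1 - q ^ (k + 1))

theorem norm_pow_succ_le {q : ℂ} (hq : ‖q‖ ≤ 1 / 2) (k : ℕ) :
    ‖q ^ (k + 1)‖ ≤ (1 / 2) ^ (k + 1) := by
  rw [norm_pow]
  gcongr

theorem norm_pow_succ_le_half {q : ℂ} (hq : ‖q‖ ≤ 1 / 2) (k : ℕ) : ‖q ^ (k + 1)‖ ≤ 1 / 2 :=
  (norm_pow_succ_le hq k).trans <|
    (pow_le_pow_of_le_one (by norm_num) (by norm_num) (Nat.le_add_left 1 k)).trans (by norm_num)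

theorem one_sub_pow_succ_ne_zero {q : ℂ} (hq : ‖q‖ ≤ 1 / 2) (k : ℕ) : 1 - q ^ (k + 1) ≠ 0 := by
  intro h
  have h1 := norm_pow_succ_le_half hq k
  rw [← sub_eq_zero.mp h, norm_one] at h1
  norm_num at h1

theorem one_sub_pow_succ_mem_slitPlane {q : ℂ} (hq : ‖q‖ ≤ 1 / 2) (k : ℕ) :
    1 - q ^ (k + 1) ∈ Complex.slitPlane := by
  rw [sub_eq_add_neg]
  apply Complex.mem_slitPlane_of_norm_lt_one
  rw [norm_neg]
  exact (norm_pow_succ_le_half hq k).trans_lt (by norm_num)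

theorem norm_log_one_sub_pow_succ_le {q : ℂ} (hq : ‖q‖ ≤ 1 / 2) (k : ℕ) :
    ‖-Complex.log (1 - q ^ (k + 1))‖ ≤ 3 / 2 * (1 / 2) ^ (k + 1) := by
  rw [norm_neg, sub_eq_add_neg]
  refine (Complex.norm_log_one_add_half_le_self ?_).trans ?_
  · rw [norm_neg]
    exact norm_pow_succ_le_half hq k
  · rw [norm_neg]
    gcongr
    exact norm_pow_succ_le hq k

theorem summable_half_pow_succ : Summable fun k : ℕ => (3 / 2 : ℝ) * (1 / 2) ^ (k + 1) :=
  ((summable_nat_add_iff 1).mpr summable_geometric_two).mul_left _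

/-- Near `q = 0` all principal logarithms are small, so that the product is the exponential of a
sum. The disc of radius `1 / 2` suffices for the Taylor coefficients. -/
theorem etaProduct_eq_exp (z : ℂ) {q : ℂ} (hq : ‖q‖ ≤ 1 / 2) :
    etaProduct z q = Complex.exp (z * etaLog q) := by
  have hs : Summable fun k : ℕ => -Complex.log (1 - q ^ (k + 1)) :=
    .of_norm_bounded summable_half_pow_succ (norm_log_one_sub_pow_succ_le hq)
  have hp := (hs.hasSum.mul_left z).cexp.tprod_eq
  rw [etaProduct, etaLog, ← hp]
  refine tprod_congr fun k => ?_
  rw [Complex.cpow_def_of_ne_zero (one_sub_pow_succ_ne_zero hq k), Function.comp_apply]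
  ring_nf

theorem hasDerivAt_neg_log_one_sub_pow_succ {q : ℂ} (hq : ‖q‖ ≤ 1 / 2) (k : ℕ) :
    HasDerivAt (fun q : ℂ => -Complex.log (1 - q ^ (k + 1)))
      ((k + 1) * q ^ k / (1 - q ^ (k + 1))) q := by
  have h := (((hasDerivAt_pow (k + 1) q).const_sub 1).clog
    (one_sub_pow_succ_mem_slitPlane hq k)).neg
  convert! h using 1
  simp [neg_div]

theorem norm_le_half_of_mem_ball {q : ℂ} (hq : q ∈ Metric.ball (0 : ℂ) (1 / 2)) : ‖q‖ ≤ 1 / 2 :=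
  (mem_ball_zero_iff.mp hq).le

theorem differentiableOn_etaLog : DifferentiableOn ℂ etaLog (Metric.ball 0 (1 / 2)) :=
  Complex.differentiableOn_tsum_of_summable_norm summable_half_pow_succ
    (fun k _ hq => (hasDerivAt_neg_log_one_sub_pow_succ
      (norm_le_half_of_mem_ball hq) k).differentiableAt.differentiableWithinAt)
    Metric.isOpen_ball fun k _ hq => norm_log_one_sub_pow_succ_le (norm_le_half_of_mem_ball hq) k

theorem deriv_etaLog_eq_tsum_div {q : ℂ} (hq : q ∈ Metric.ball (0 : ℂ) (1 / 2)) :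
    deriv etaLog q = ∑' k : ℕ, (k + 1) * q ^ k / (1 - q ^ (k + 1)) := by
  have h := Complex.hasSum_deriv_of_summable_norm summable_half_pow_succ
    (fun k _ hq => (hasDerivAt_neg_log_one_sub_pow_succ
      (norm_le_half_of_mem_ball hq) k).differentiableAt.differentiableWithinAt)
    Metric.isOpen_ball
    (fun k _ hq => norm_log_one_sub_pow_succ_le (norm_le_half_of_mem_ball hq) k) hq
  rw [show etaLog = fun w : ℂ => ∑' k : ℕ, -Complex.log (1 - w ^ (k + 1)) from rfl, ← h.tsum_eq]
  exact tsum_congr fun k =>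
    (hasDerivAt_neg_log_one_sub_pow_succ (norm_le_half_of_mem_ball hq) k).deriv

/-- Expanding each term of the logarithmic derivative geometrically turns it into a Lambert
series, whose coefficients are sums of divisors. -/
theorem deriv_etaLog_eq_tsum_sigma {q : ℂ} (hq : q ∈ Metric.ball (0 : ℂ) (1 / 2)) :
    deriv etaLog q = ∑' n : ℕ, (σ 1 (n + 1) : ℂ) * q ^ n := by
  rw [deriv_etaLog_eq_tsum_div hq]
  have hq1 : ‖q‖ < 1 := (norm_le_half_of_mem_ball hq).trans_lt (by norm_num)
  rcases eq_or_ne q 0 with rfl | hq0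
  · rw [tsum_eq_single 0 (by simp +contextual), tsum_eq_single 0 (by simp +contextual)]
    simp
  · have h := tsum_pow_div_one_sub_eq_tsum_sigma hq1 1
    rw [tsum_pnat_eq_tsum_succ (f := fun n : ℕ => (n : ℂ) ^ 1 * q ^ n / (1 - q ^ n)),
      tsum_pnat_eq_tsum_succ (f := fun n : ℕ => (σ 1 n : ℂ) * q ^ n)] at h
    apply mul_left_cancel₀ hq0
    rw [← tsum_mul_left, ← tsum_mul_left]
    convert! h using 1
    · refine tsum_congr fun k => ?_
      push_cast
      ring
    · refine tsum_congr fun k => ?_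
      ring

theorem summable_sigma_mul_pow {q : ℂ} (hq : ‖q‖ < 1) :
    Summable fun n : ℕ => (σ 1 (n + 1) : ℂ) * q ^ n := by
  rcases eq_or_ne q 0 with rfl | hq0
  · exact summable_of_ne_finset_zero (s := {0}) (by simp +contextual)
  have h : Summable fun n : ℕ => (σ 1 n : ℂ) * q ^ n := by
    refine .of_norm_bounded (summable_norm_pow_mul_geometric_of_norm_lt_one 2 hq) fun n => ?_
    rw [norm_mul, norm_mul]
    gcongr
    rw [← Nat.cast_pow, Complex.norm_natCast, Complex.norm_natCast]
    exact_mod_cast ArithmeticFunction.sigma_le_pow_succ 1 n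
  refine (((summable_nat_add_iff 1).mpr h).mul_left q⁻¹).congr fun n => ?_
  field_simp
  ring

theorem analyticAt_etaLog : AnalyticAt ℂ etaLog 0 :=
  differentiableOn_etaLog.analyticAt (Metric.ball_mem_nhds _ (by norm_num))

theorem analyticAt_etaProduct (z : ℂ) : AnalyticAt ℂ (etaProduct z) 0 := by
  have h : AnalyticAt ℂ (fun q => Complex.exp (z * etaLog q)) 0 :=
    (analyticAt_const.mul analyticAt_etaLog).cexp
  refine h.congr ?_
  filter_upwards [Metric.ball_mem_nhds (0 : ℂ) (by norm_num : (0 : ℝ) < 1 / 2)] with q hq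
  exact (etaProduct_eq_exp z (norm_le_half_of_mem_ball hq)).symm

theorem iteratedDeriv_deriv_etaLog (n : ℕ) :
    iteratedDeriv n (deriv etaLog) 0 = n.factorial * (σ 1 (n + 1) : ℂ) := by
  have h1 := analyticAt_etaLog.deriv.hasFPowerSeriesAt
  have h2 : HasFPowerSeriesAt (deriv etaLog)
      (FormalMultilinearSeries.ofScalars ℂ fun n => (σ 1 (n + 1) : ℂ)) 0 := by
    rw [hasFPowerSeriesAt_iff']
    filter_upwards [Metric.ball_mem_nhds (0 : ℂ) (by norm_num : (0 : ℝ) < 1 / 2)] with q hq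
    rw [deriv_etaLog_eq_tsum_sigma hq]
    have hq1 : ‖q‖ < 1 := (norm_le_half_of_mem_ball hq).trans_lt (by norm_num)
    convert! (summable_sigma_mul_pow hq1).hasSum using 2 with n
    simp [mul_comm]
  have h3 := congr_arg (fun p => FormalMultilinearSeries.coeff p n)
    (h1.eq_formalMultilinearSeries h2)
  simp only [FormalMultilinearSeries.coeff_ofScalars] at h3
  rw [← h3, mul_div_cancel₀ _ (Nat.cast_ne_zero.mpr n.factorial_ne_zero)]

theorem deriv_etaProduct_eventuallyEq (z : ℂ) :
    deriv (etaProduct z) =ᶠ[𝓝 0] fun q => z * (deriv etaLog q * etaProduct z q) := by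
  filter_upwards [Metric.ball_mem_nhds (0 : ℂ) (by norm_num : (0 : ℝ) < 1 / 2)] with q hq
  have hd : DifferentiableAt ℂ etaLog q :=
    differentiableOn_etaLog.differentiableAt (Metric.isOpen_ball.mem_nhds hq)
  have he : etaProduct z =ᶠ[𝓝 q] fun q => Complex.exp (z * etaLog q) := by
    filter_upwards [Metric.isOpen_ball.mem_nhds hq] with w hw
    exact etaProduct_eq_exp z (norm_le_half_of_mem_ball hw)
  rw [he.deriv_eq, he.eq_of_nhds, (hd.hasDerivAt.const_mul z).cexp.deriv]
  ring

theorem etaCoeff_zero (z : ℂ) : etaCoeff 0 z = 1 := by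
  simp [etaCoeff, etaProduct]

/-- The recurrence `(n + 1) P_{n+1}(z) = z ∑_{i ≤ n} σ(i + 1) P_{n-i}(z)`. -/
theorem succ_mul_etaCoeff_succ (n : ℕ) (z : ℂ) :
    (n + 1) * etaCoeff (n + 1) z =
      z * ∑ i ∈ Finset.range (n + 1), (σ 1 (i + 1) : ℂ) * etaCoeff (n - i) z := by
  have h : iteratedDeriv (n + 1) (etaProduct z) 0 = z * ∑ i ∈ Finset.range (n + 1),
      (n.choose i : ℂ) * iteratedDeriv i (deriv etaLog) 0 *
        iteratedDeriv (n - i) (etaProduct z) 0 := by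
    rw [iteratedDeriv_succ', (deriv_etaProduct_eventuallyEq z).iteratedDeriv_eq,
      iteratedDeriv_const_mul_field, iteratedDeriv_fun_mul analyticAt_etaLog.deriv.contDiffAt
        (analyticAt_etaProduct z).contDiffAt]
  rw [etaCoeff, h, Nat.factorial_succ, Finset.mul_sum, Finset.mul_sum, Finset.sum_div,
    Finset.mul_sum]
  refine Finset.sum_congr rfl fun i hi => ?_
  have hin : i ≤ n := Nat.lt_succ_iff.mp (Finset.mem_range.mp hi)
  rw [iteratedDeriv_deriv_etaLog, etaCoeff, Nat.cast_choose ℂ hin]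
  have h1 : ((n + 1 : ℕ) : ℂ) ≠ 0 := Nat.cast_ne_zero.mpr n.succ_ne_zero
  have h2 (m : ℕ) : (m.factorial : ℂ) ≠ 0 := Nat.cast_ne_zero.mpr m.factorial_ne_zero
  have := h2 n
  have := h2 i
  have := h2 (n - i)
  push_cast at h1 ⊢
  field_simp

/-! ### The real coefficients and a lower bound for them -/

/-- `P_n(x)` as a real number, for real `x`. -/
noncomputable def etaCoeffRe (n : ℕ) (x : ℝ) : ℝ := (etaCoeff n x).re

theorem ofReal_etaCoeffRe (n : ℕ) (x : ℝ) : (etaCoeffRe n x : ℂ) = etaCoeff n x := by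
  suffices h : ∃ r : ℝ, etaCoeff n x = r by
    obtain ⟨r, hr⟩ := h
    rw [etaCoeffRe, hr, Complex.ofReal_re]
  induction n using Nat.strong_induction_on with
  | _ n ih =>
    rcases n with _ | n
    · exact ⟨1, by rw [etaCoeff_zero, Complex.ofReal_one]⟩
    · choose! r hr using ih
      refine ⟨x * (∑ i ∈ Finset.range (n + 1), (σ 1 (i + 1) : ℝ) * r (n - i)) / (n + 1), ?_⟩
      have h0 : (n + 1 : ℂ) ≠ 0 := Nat.cast_add_one_ne_zero n
      have hs : ∑ i ∈ Finset.range (n + 1), (σ 1 (i + 1) : ℂ) * etaCoeff (n - i) x =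
          ∑ i ∈ Finset.range (n + 1), (σ 1 (i + 1) : ℂ) * r (n - i) :=
        Finset.sum_congr rfl fun i _ => by rw [hr (n - i) (by omega)]
      push_cast
      rw [← hs, ← succ_mul_etaCoeff_succ]
      field_simp

theorem etaCoeffRe_zero (x : ℝ) : etaCoeffRe 0 x = 1 := by
  rw [etaCoeffRe, etaCoeff_zero, Complex.one_re]

theorem succ_mul_etaCoeffRe_succ (n : ℕ) (x : ℝ) :
    (n + 1) * etaCoeffRe (n + 1) x =
      x * ∑ j ∈ Finset.range (n + 1), (σ 1 (n + 1 - j) : ℝ) * etaCoeffRe j x := by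
  have h := succ_mul_etaCoeff_succ n (x : ℂ)
  simp only [← ofReal_etaCoeffRe] at h
  rw [← Finset.sum_range_reflect (fun j => (σ 1 (n + 1 - j) : ℝ) * etaCoeffRe j x)]
  have h' : ∑ j ∈ Finset.range (n + 1),
      (σ 1 (n + 1 - (n + 1 - 1 - j)) : ℝ) * etaCoeffRe (n + 1 - 1 - j) x =
      ∑ j ∈ Finset.range (n + 1), (σ 1 (j + 1) : ℝ) * etaCoeffRe (n - j) x := by
    refine Finset.sum_congr rfl fun j hj => ?_
    have hj := Finset.mem_range.mp hj
    rw [show n + 1 - (n + 1 - 1 - j) = j + 1 by omega, Nat.add_sub_cancel]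
  rw [h']
  exact_mod_cast h

theorem etaCoeffRe_nonneg (n : ℕ) {x : ℝ} (hx : 0 ≤ x) : 0 ≤ etaCoeffRe n x := by
  induction n using Nat.strong_induction_on with
  | _ n ih =>
    rcases n with _ | n
    · simp [etaCoeffRe_zero]
    · have h := succ_mul_etaCoeffRe_succ n x
      have h0 : (0 : ℝ) < n + 1 := by positivity
      refine nonneg_of_mul_nonneg_right (h ▸ mul_nonneg hx ?_) h0
      exact Finset.sum_nonneg fun j hj =>
        mul_nonneg (Nat.cast_nonneg _) (ih j (Finset.mem_range.mp hj))

theorem le_sigma_one (n : ℕ) : n ≤ σ 1 n := by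
  rcases eq_or_ne n 0 with rfl | hn
  · simp
  · rw [ArithmeticFunction.sigma_one_apply]
    exact Finset.single_le_sum (f := fun d => d) (fun _ _ => Nat.zero_le _)
      (Nat.mem_divisors_self n hn)

/-- A divisor of `n` other than `n` is at most `n / 2`. -/
theorem sigma_one_le (n : ℕ) : (σ 1 n : ℝ) ≤ n * (n + 10) / 8 := by
  have h1 : n.divisors ⊆ insert n (Finset.range (n / 2 + 1)) := by
    intro d hd
    obtain ⟨⟨c, hc⟩, hn⟩ := Nat.mem_divisors.mp hd
    rw [Finset.mem_insert, Finset.mem_range]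
    rcases c with _ | _ | c
    · simp_all
    · left; simp_all
    · right
      have : d * 2 ≤ n := hc ▸ Nat.mul_le_mul_left d (by omega)
      omega
  have h2 : σ 1 n ≤ n + ∑ d ∈ Finset.range (n / 2 + 1), d := by
    rw [ArithmeticFunction.sigma_one_apply]
    refine (Finset.sum_le_sum_of_subset h1).trans ?_
    by_cases h : n ∈ Finset.range (n / 2 + 1)
    · rw [Finset.insert_eq_of_mem h]
      exact Nat.le_add_left _ _
    · rw [Finset.sum_insert h]
  have h3 : (∑ d ∈ Finset.range (n / 2 + 1), d) * 2 = (n / 2 + 1) * (n / 2) :=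
    Finset.sum_range_id_mul_two _
  have h4 : ((n / 2 : ℕ) : ℝ) ≤ n / 2 := Nat.cast_div_le
  have h5 : ((∑ d ∈ Finset.range (n / 2 + 1), d : ℕ) : ℝ) * 2 =
      ((n / 2 : ℕ) + 1) * (n / 2 : ℕ) := by exact_mod_cast h3
  have h6 : (σ 1 n : ℝ) ≤ n + (∑ d ∈ Finset.range (n / 2 + 1), d : ℕ) := by exact_mod_cast h2
  have h7 : (0 : ℝ) ≤ (n / 2 : ℕ) := Nat.cast_nonneg _
  nlinarith

theorem sum_range_succ_choose (n m : ℕ) :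
    ∑ j ∈ Finset.range (n + 1), j.choose m = (n + 1).choose (m + 1) := by
  induction n with
  | zero => cases m <;> simp [Nat.choose_succ_succ]
  | succ n ih => rw [Finset.sum_range_succ, ih, Nat.choose_succ_succ (n + 1) m, Nat.add_comm]

theorem sum_range_sub_mul_choose (n m : ℕ) :
    ∑ j ∈ Finset.range n, (n - j) * j.choose m = (n + 1).choose (m + 2) := by
  induction n with
  | zero => simp [Nat.choose_succ_succ]
  | succ n ih =>
    have h : ∑ j ∈ Finset.range (n + 1), (n + 1 - j) * j.choose m =
        ∑ j ∈ Finset.range (n + 1), (n - j) * j.choose m +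
          ∑ j ∈ Finset.range (n + 1), j.choose m := by
      rw [← Finset.sum_add_distrib]
      refine Finset.sum_congr rfl fun j hj => ?_
      have hj := Finset.mem_range.mp hj
      rw [show n + 1 - j = (n - j) + 1 by omega]
      ring
    rw [h, Finset.sum_range_succ, ih, Nat.sub_self, Nat.zero_mul, Nat.add_zero,
      sum_range_succ_choose, Nat.choose_succ_succ (n + 1) (m + 1), Nat.add_comm]

/-- Truncations of the coefficients of `exp (x q / (1 - q))`, which bound `P_n(x)` from below
because `σ(k) ≥ k`. -/
theorem sum_choose_mul_pow_le_etaCoeffRe (M n : ℕ) {x : ℝ} (hx : 0 ≤ x) :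
    ∑ m ∈ Finset.range M, (n.choose m : ℝ) * x ^ (m + 1) / (m + 1).factorial ≤
      etaCoeffRe (n + 1) x := by
  induction M generalizing n with
  | zero => simpa using etaCoeffRe_nonneg (n + 1) hx
  | succ M ih =>
    have h0 : (0 : ℝ) < n + 1 := by positivity
    refine le_of_mul_le_mul_left ?_ h0
    have hsig : ∑ j ∈ Finset.range (n + 1), ((n + 1 - j : ℕ) : ℝ) * etaCoeffRe j x ≤
        ∑ j ∈ Finset.range (n + 1), (σ 1 (n + 1 - j) : ℝ) * etaCoeffRe j x := by
      refine Finset.sum_le_sum fun j _ => ?_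
      have := etaCoeffRe_nonneg j hx
      gcongr
      exact le_sigma_one _
    have hind : ∑ j ∈ Finset.range n, ((n - j : ℕ) : ℝ) *
        ∑ m ∈ Finset.range M, (j.choose m : ℝ) * x ^ (m + 1) / (m + 1).factorial ≤
        ∑ j ∈ Finset.range n, ((n - j : ℕ) : ℝ) * etaCoeffRe (j + 1) x := by
      gcongr with j _
      exact ih j
    -- Convolving the bound for `M` with `k ↦ k` shifts both indices of the binomial coefficients.
    have hsum : ∑ j ∈ Finset.range n, ((n - j : ℕ) : ℝ) *
        ∑ m ∈ Finset.range M, (j.choose m : ℝ) * x ^ (m + 1) / (m + 1).factorial =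
        ∑ m ∈ Finset.range M, ((n + 1).choose (m + 2) : ℝ) * (x ^ (m + 1) / (m + 1).factorial) := by
      simp_rw [Finset.mul_sum]
      rw [Finset.sum_comm]
      refine Finset.sum_congr rfl fun m _ => ?_
      rw [← sum_range_sub_mul_choose, Nat.cast_sum, Finset.sum_mul]
      refine Finset.sum_congr rfl fun j _ => ?_
      push_cast
      ring
    rw [succ_mul_etaCoeffRe_succ]
    refine le_trans ?_ (mul_le_mul_of_nonneg_left hsig hx)
    rw [Finset.sum_range_succ' _ n, etaCoeffRe_zero]
    simp only [Nat.add_sub_add_right, Nat.sub_zero]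
    refine le_trans ?_ (mul_le_mul_of_nonneg_left (add_le_add_left (hsum ▸ hind) _) hx)
    rw [Finset.sum_range_succ', mul_add, mul_add, Finset.mul_sum, Finset.mul_sum]
    refine add_le_add (Finset.sum_le_sum fun m _ => le_of_eq ?_) (le_of_eq ?_)
    · have h := Nat.add_one_mul_choose_eq n (m + 1)
      have h' : ((n : ℝ) + 1) * n.choose (m + 1) = (n + 1).choose (m + 2) * (m + 2) := by
        exact_mod_cast h
      rw [Nat.factorial_succ (m + 1)]
      have hf : ((m + 1).factorial : ℝ) ≠ 0 := Nat.cast_ne_zero.mpr (Nat.factorial_ne_zero _)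
      push_cast
      field_simp
      linear_combination x ^ (m + 2) * h'
    · simp
      ring

theorem quartic_le_etaCoeffRe (n : ℕ) {x : ℝ} (hx : 0 ≤ x) :
    x + n * x ^ 2 / 2 + n * (n - 1) / 2 * x ^ 3 / 6 + n * (n - 1) * (n - 2) / 6 * x ^ 4 / 24 ≤
      etaCoeffRe (n + 1) x := by
  have h3 : (n.choose 3 : ℝ) = n * (n - 1) * (n - 2) / 6 := by
    induction n with
    | zero => simp
    | succ n ih =>
      rw [Nat.choose_succ_succ, Nat.cast_add, ih, Nat.cast_choose_two]
      push_cast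
      ring
  refine le_of_eq_of_le ?_ (sum_choose_mul_pow_le_etaCoeffRe 4 n hx)
  simp only [Finset.sum_range_succ, Finset.sum_range_zero, Nat.cast_choose_two, h3]
  norm_num [Nat.factorial]

/-! ### Explicit values -/

/-- The values of the sum of divisors that the explicit coefficients and the estimates for small
indices use. -/
theorem sigma_one_values :
    σ 1 1 = 1 ∧ σ 1 2 = 3 ∧ σ 1 3 = 4 ∧ σ 1 4 = 7 ∧ σ 1 5 = 6 ∧ σ 1 6 = 12 ∧ σ 1 7 = 8 ∧
    σ 1 8 = 15 ∧ σ 1 9 = 13 ∧ σ 1 10 = 18 ∧ σ 1 11 = 12 ∧ σ 1 12 = 28 ∧ σ 1 13 = 14 ∧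
    σ 1 14 = 24 ∧ σ 1 15 = 24 ∧ σ 1 16 = 31 ∧ σ 1 17 = 18 := by
  decide

theorem etaCoeffRe_one (x : ℝ) : etaCoeffRe 1 x = x := by
  have h := succ_mul_etaCoeffRe_succ 0 x
  simp only [Finset.sum_range_succ, Finset.sum_range_zero, etaCoeffRe_zero,
    Nat.reduceAdd, Nat.reduceSub, sigma_one_values] at h
  push_cast at h
  linarith

theorem etaCoeffRe_two (x : ℝ) : etaCoeffRe 2 x = x * (x + 3) / 2 := by
  have h := succ_mul_etaCoeffRe_succ 1 x
  simp only [Finset.sum_range_succ, Finset.sum_range_zero, etaCoeffRe_zero, etaCoeffRe_one,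
    Nat.reduceAdd, Nat.reduceSub, sigma_one_values] at h
  push_cast at h
  linarith

theorem etaCoeffRe_three (x : ℝ) : etaCoeffRe 3 x = x * (x + 1) * (x + 8) / 6 := by
  have h := succ_mul_etaCoeffRe_succ 2 x
  simp only [Finset.sum_range_succ, Finset.sum_range_zero, etaCoeffRe_zero, etaCoeffRe_one,
    etaCoeffRe_two, Nat.reduceAdd, Nat.reduceSub, sigma_one_values] at h
  push_cast at h
  linarith

theorem etaCoeffRe_four (x : ℝ) :
    etaCoeffRe 4 x = x * (x + 1) * (x + 3) * (x + 14) / 24 := by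
  have h := succ_mul_etaCoeffRe_succ 3 x
  simp only [Finset.sum_range_succ, Finset.sum_range_zero, etaCoeffRe_zero, etaCoeffRe_one,
    etaCoeffRe_two, etaCoeffRe_three, Nat.reduceAdd, Nat.reduceSub, sigma_one_values] at h
  push_cast at h
  linarith

theorem etaCoeffRe_five (x : ℝ) :
    etaCoeffRe 5 x = x * (x + 3) * (x + 6) * (x ^ 2 + 21 * x + 8) / 120 := by
  have h := succ_mul_etaCoeffRe_succ 4 x
  simp only [Finset.sum_range_succ, Finset.sum_range_zero, etaCoeffRe_zero, etaCoeffRe_one,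
    etaCoeffRe_two, etaCoeffRe_three, etaCoeffRe_four, Nat.reduceAdd, Nat.reduceSub,
    sigma_one_values] at h
  push_cast at h
  linarith

/-! ### The recurrence for the differences -/

/-- The sequence `n ↦ Δ_{n,b}(x)` for real `x`, extended to `n = 0` by the convention
`P_{-1} = 0`. -/
noncomputable def etaDeltaRe (b : ℕ) (x : ℝ) : ℕ → ℝ
  | 0 => -etaCoeffRe b x
  | n + 1 => etaCoeffRe n x * etaCoeffRe (b + 1) x - etaCoeffRe (n + 1) x * etaCoeffRe b x

theorem ofReal_etaDeltaRe {a : ℕ} (ha : 1 ≤ a) (b : ℕ) (x : ℝ) :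
    (etaDeltaRe b x a : ℂ) = etaDelta a b x := by
  obtain ⟨n, rfl⟩ := Nat.exists_eq_add_of_le' ha
  simp [etaDeltaRe, etaDelta, ofReal_etaCoeffRe]

/-- The differences satisfy the recurrence of the coefficients with the additional term
`P_n P_{b+1}`, which comes from the mismatch between the factors `n` and `n + 1`. -/
theorem succ_mul_etaDeltaRe_succ (b n : ℕ) (x : ℝ) :
    (n + 1) * etaDeltaRe b x (n + 1) = etaCoeffRe n x * etaCoeffRe (b + 1) x +
      x * ∑ j ∈ Finset.range (n + 1), (σ 1 (n + 1 - j) : ℝ) * etaDeltaRe b x j := by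
  have h1 := succ_mul_etaCoeffRe_succ n x
  have h2 : (n : ℝ) * etaCoeffRe n x =
      x * ∑ j ∈ Finset.range n, (σ 1 (n - j) : ℝ) * etaCoeffRe j x := by
    rcases n with _ | n
    · simp
    · exact_mod_cast succ_mul_etaCoeffRe_succ n x
  have h3 : ∑ j ∈ Finset.range (n + 1), (σ 1 (n + 1 - j) : ℝ) * etaDeltaRe b x j =
      (∑ j ∈ Finset.range n, (σ 1 (n - j) : ℝ) * etaCoeffRe j x) * etaCoeffRe (b + 1) x -
      (∑ j ∈ Finset.range (n + 1), (σ 1 (n + 1 - j) : ℝ) * etaCoeffRe j x) *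
        etaCoeffRe b x := by
    rw [Finset.sum_range_succ', Finset.sum_range_succ' _ n, add_mul, Finset.sum_mul,
      Finset.sum_mul, ← sub_sub, ← Finset.sum_sub_distrib]
    simp only [etaDeltaRe, Nat.add_sub_add_right, etaCoeffRe_zero]
    rw [sub_eq_add_neg]
    congr 1
    · exact Finset.sum_congr rfl fun j _ => by ring
    · ring
  rw [h3, etaDeltaRe]
  linear_combination etaCoeffRe (b + 1) x * h2 - etaCoeffRe b x * h1

/-- Only the terms with `j ≤ b` of the recurrence can be negative: `Δ_{b+1,b} = 0`, and the later
ones are positive by induction. So `Δ_{a,b}` is positive for all `a ≥ b + 2` as soon as these terms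
are outweighed by `P_{a-1} P_{b+1}`. -/
theorem etaDeltaRe_pos_of_forall {b : ℕ} {x : ℝ} (hx : 0 ≤ x)
    (h : ∀ n, b + 1 ≤ n → 0 < etaCoeffRe n x * etaCoeffRe (b + 1) x +
      x * ∑ j ∈ Finset.range (b + 1), (σ 1 (n + 1 - j) : ℝ) * etaDeltaRe b x j)
    {a : ℕ} (ha : b + 2 ≤ a) : 0 < etaDeltaRe b x a := by
  induction a using Nat.strong_induction_on with
  | _ a ih =>
    obtain ⟨n, rfl⟩ := Nat.exists_eq_add_of_le' (show 1 ≤ a by omega)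
    have h0 : (0 : ℝ) < n + 1 := by positivity
    refine pos_of_mul_pos_right ((h n (by omega)).trans_le ?_) h0.le
    rw [succ_mul_etaDeltaRe_succ]
    gcongr _ + x * ?_
    refine Finset.sum_le_sum_of_subset_of_nonneg (Finset.range_subset_range.mpr (by omega)) ?_
    intro j hj hjb
    rw [Finset.mem_range] at hj hjb
    refine mul_nonneg (Nat.cast_nonneg _) ?_
    rcases Nat.lt_or_ge (b + 1) j with hbj | hbj
    · exact (ih j hj hbj).le
    · obtain rfl : j = b + 1 := by omega
      rw [etaDeltaRe, mul_comm, sub_self]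

/-! ### The estimates for `b = 1, 2, 3` -/

theorem neg_mul_le_mul_of_le {s S d e : ℝ} (hs : 0 ≤ s) (hsS : s ≤ S) (he : 0 ≤ e)
    (hd : -e ≤ d) : -(S * e) ≤ s * d := by
  nlinarith [mul_le_mul_of_nonneg_left hd hs, mul_le_mul_of_nonneg_right hsS he]

/-- A lower bound for a term of the recurrence for the differences, in which the irregular factor
`σ(k)` is replaced by a polynomial in `n`. It is applied to `d = Δ_{j,b}` as a polynomial in
`y = x - x₀`, with `-e` the sum of the monomials of `d` that have negative coefficients. -/
theorem neg_mul_le_sigma_one_mul {k n : ℕ} (hk : k ≤ n) {d e : ℝ} (he : 0 ≤ e) (hd : -e ≤ d) :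
    -(n * (n + 10) / 8 * e) ≤ (σ 1 k : ℝ) * d :=
  neg_mul_le_mul_of_le (Nat.cast_nonneg _) ((sigma_one_le k).trans (by gcongr)) he hd

theorem etaDeltaRe_one_pos {x : ℝ} (hx : 1 < x) {a : ℕ} (ha : 3 ≤ a) :
    0 < etaDeltaRe 1 x a := by
  refine etaDeltaRe_pos_of_forall (by linarith) (fun n hn => ?_) ha
  -- In terms of `y = x - 1` the polynomials left to estimate have nonnegative coefficients.
  obtain ⟨y, rfl⟩ : ∃ y, x = 1 + y := ⟨x - 1, by ring⟩
  have hy : 0 < y := by linarith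
  simp only [Finset.sum_range_succ, Finset.sum_range_zero]
  obtain ⟨n, rfl⟩ := Nat.exists_eq_add_of_le' (show 1 ≤ n by omega)
  have hq := mul_le_mul_of_nonneg_right (quartic_le_etaCoeffRe n (x := 1 + y) (by linarith))
    (etaCoeffRe_nonneg 2 (x := 1 + y) (by linarith))
  refine lt_of_lt_of_le ?_ (add_le_add_left hq _)
  rcases Nat.lt_or_ge n 9 with hnlt | hnge
  · simp only [etaDeltaRe, etaCoeffRe_zero, etaCoeffRe_one, etaCoeffRe_two, Nat.reduceAdd]
    interval_cases n
    all_goals first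
      | omega
      | simp only [Nat.reduceAdd, Nat.reduceSub, sigma_one_values]
        push_cast
        ring_nf
        positivity
  -- From this index on, the polynomial in `y` and `t` that bounds the sum has nonnegative
  -- coefficients.
  · obtain ⟨t, rfl⟩ := Nat.exists_eq_add_of_le hnge
    have h0 := neg_mul_le_sigma_one_mul (Nat.sub_le (9 + t + 1 + 1) 0)
      (show 0 ≤ 1 + y by positivity)
      (show -(1 + y) ≤ etaDeltaRe 1 (1 + y) 0 by
        rw [← sub_nonneg]
        simp only [etaDeltaRe, etaCoeffRe_one]
        ring_nf
        positivity)
    have h1 := neg_mul_le_sigma_one_mul (Nat.sub_le (9 + t + 1 + 1) 1)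
      (show 0 ≤ y ^ 2 / 2 by positivity)
      (show -(y ^ 2 / 2) ≤ etaDeltaRe 1 (1 + y) 1 by
        rw [← sub_nonneg]
        simp only [etaDeltaRe, Nat.reduceAdd, etaCoeffRe_zero, etaCoeffRe_one, etaCoeffRe_two]
        ring_nf
        positivity)
    have hsum := mul_le_mul_of_nonneg_left
      (add_le_add h0 h1) (show 0 ≤ 1 + y by positivity)
    rw [zero_add]
    refine lt_of_lt_of_le ?_ (add_le_add_right hsum _)
    rw [etaCoeffRe_two]
    push_cast
    ring_nf
    positivity

theorem etaDeltaRe_two_pos {x : ℝ} (hx : 2 < x) {a : ℕ} (ha : 4 ≤ a) :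
    0 < etaDeltaRe 2 x a := by
  refine etaDeltaRe_pos_of_forall (by linarith) (fun n hn => ?_) ha
  obtain ⟨y, rfl⟩ : ∃ y, x = 2 + y := ⟨x - 2, by ring⟩
  have hy : 0 < y := by linarith
  simp only [Finset.sum_range_succ, Finset.sum_range_zero]
  -- As `Δ_{4,2}(2) = 0`, the step `n = 3` leaves no room and needs the exact value of `P_3`.
  rcases eq_or_ne n 3 with rfl | hn3
  · simp only [etaDeltaRe, etaCoeffRe_zero, etaCoeffRe_one, etaCoeffRe_two, etaCoeffRe_three,
      Nat.reduceAdd, Nat.reduceSub, sigma_one_values]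
    push_cast
    ring_nf
    positivity
  obtain ⟨n, rfl⟩ := Nat.exists_eq_add_of_le' (show 1 ≤ n by omega)
  have hq := mul_le_mul_of_nonneg_right (quartic_le_etaCoeffRe n (x := 2 + y) (by linarith))
    (etaCoeffRe_nonneg 3 (x := 2 + y) (by linarith))
  refine lt_of_lt_of_le ?_ (add_le_add_left hq _)
  rcases Nat.lt_or_ge n 5 with hnlt | hnge
  · simp only [etaDeltaRe, etaCoeffRe_zero, etaCoeffRe_one, etaCoeffRe_two, etaCoeffRe_three,
      Nat.reduceAdd]
    interval_cases n
    all_goals first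
      | omega
      | simp only [Nat.reduceAdd, Nat.reduceSub, sigma_one_values]
        push_cast
        ring_nf
        positivity
  · obtain ⟨t, rfl⟩ := Nat.exists_eq_add_of_le hnge
    have h0 := neg_mul_le_sigma_one_mul (Nat.sub_le (5 + t + 1 + 1) 0)
      (show 0 ≤ 5 + 7 / 2 * y + y ^ 2 / 2 by positivity)
      (show -(5 + 7 / 2 * y + y ^ 2 / 2) ≤ etaDeltaRe 2 (2 + y) 0 by
        rw [← sub_nonneg]
        simp only [etaDeltaRe, etaCoeffRe_two]
        ring_nf
        positivity)
    have h1 := neg_mul_le_sigma_one_mul (Nat.sub_le (5 + t + 1 + 1) 1)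
      (show 0 ≤ 8 / 3 * y + 2 * y ^ 2 + y ^ 3 / 3 by positivity)
      (show -(8 / 3 * y + 2 * y ^ 2 + y ^ 3 / 3) ≤ etaDeltaRe 2 (2 + y) 1 by
        rw [← sub_nonneg]
        simp only [etaDeltaRe, Nat.reduceAdd, etaCoeffRe_zero, etaCoeffRe_one, etaCoeffRe_two,
          etaCoeffRe_three]
        ring_nf
        positivity)
    have h2 := neg_mul_le_sigma_one_mul (Nat.sub_le (5 + t + 1 + 1) 2)
      (show 0 ≤ 5 + 19 / 3 * y + 35 / 12 * y ^ 2 + 2 / 3 * y ^ 3 + y ^ 4 / 12 by positivity)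
      (show -(5 + 19 / 3 * y + 35 / 12 * y ^ 2 + 2 / 3 * y ^ 3 + y ^ 4 / 12) ≤
          etaDeltaRe 2 (2 + y) 2 by
        rw [← sub_nonneg]
        simp only [etaDeltaRe, Nat.reduceAdd, etaCoeffRe_one, etaCoeffRe_two, etaCoeffRe_three]
        ring_nf
        positivity)
    have hsum := mul_le_mul_of_nonneg_left
      (add_le_add (add_le_add h0 h1) h2) (show 0 ≤ 2 + y by positivity)
    rw [zero_add]
    refine lt_of_lt_of_le ?_ (add_le_add_right hsum _)
    rw [etaCoeffRe_three]
    push_cast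
    ring_nf
    positivity

theorem etaDeltaRe_three_pos {x : ℝ} (hx : 1 < x) {a : ℕ} (ha : 5 ≤ a) :
    0 < etaDeltaRe 3 x a := by
  refine etaDeltaRe_pos_of_forall (by linarith) (fun n hn => ?_) ha
  obtain ⟨y, rfl⟩ : ∃ y, x = 1 + y := ⟨x - 1, by ring⟩
  have hy : 0 < y := by linarith
  simp only [Finset.sum_range_succ, Finset.sum_range_zero]
  -- Near `x = 1` the quartic lower bound for `P_5` is too weak.
  rcases eq_or_ne n 5 with rfl | hn5
  · simp only [etaDeltaRe, etaCoeffRe_zero, etaCoeffRe_one, etaCoeffRe_two, etaCoeffRe_three,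
      etaCoeffRe_four, etaCoeffRe_five, Nat.reduceAdd, Nat.reduceSub, sigma_one_values]
    push_cast
    ring_nf
    positivity
  obtain ⟨n, rfl⟩ := Nat.exists_eq_add_of_le' (show 1 ≤ n by omega)
  have hq := mul_le_mul_of_nonneg_right (quartic_le_etaCoeffRe n (x := 1 + y) (by linarith))
    (etaCoeffRe_nonneg 4 (x := 1 + y) (by linarith))
  refine lt_of_lt_of_le ?_ (add_le_add_left hq _)
  rcases Nat.lt_or_ge n 16 with hnlt | hnge
  · simp only [etaDeltaRe, etaCoeffRe_zero, etaCoeffRe_one, etaCoeffRe_two, etaCoeffRe_three,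
      etaCoeffRe_four, Nat.reduceAdd]
    interval_cases n
    all_goals first
      | omega
      | simp only [Nat.reduceAdd, Nat.reduceSub, sigma_one_values]
        push_cast
        ring_nf
        positivity
  · obtain ⟨t, rfl⟩ := Nat.exists_eq_add_of_le hnge
    have h0 := neg_mul_le_sigma_one_mul (Nat.sub_le (16 + t + 1 + 1) 0)
      (show 0 ≤ 3 + 29 / 6 * y + 2 * y ^ 2 + y ^ 3 / 6 by positivity)
      (show -(3 + 29 / 6 * y + 2 * y ^ 2 + y ^ 3 / 6) ≤ etaDeltaRe 3 (1 + y) 0 by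
        rw [← sub_nonneg]
        simp only [etaDeltaRe, etaCoeffRe_three]
        ring_nf
        positivity)
    have h1 := neg_mul_le_sigma_one_mul (Nat.sub_le (16 + t + 1 + 1) 1)
      (show 0 ≤ 15 / 8 * y ^ 2 + 5 / 4 * y ^ 3 + y ^ 4 / 8 by positivity)
      (show -(15 / 8 * y ^ 2 + 5 / 4 * y ^ 3 + y ^ 4 / 8) ≤ etaDeltaRe 3 (1 + y) 1 by
        rw [← sub_nonneg]
        simp only [etaDeltaRe, Nat.reduceAdd, etaCoeffRe_zero, etaCoeffRe_one, etaCoeffRe_three,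
          etaCoeffRe_four]
        ring_nf
        positivity)
    have h2 := neg_mul_le_sigma_one_mul (Nat.sub_le (16 + t + 1 + 1) 2)
      (show 0 ≤ 1 + 37 / 12 * y + 85 / 24 * y ^ 2 + 15 / 8 * y ^ 3 + 11 / 24 * y ^ 4 + y ^ 5 / 24 by
        positivity)
      (show -(1 + 37 / 12 * y + 85 / 24 * y ^ 2 + 15 / 8 * y ^ 3 + 11 / 24 * y ^ 4 + y ^ 5 / 24) ≤
          etaDeltaRe 3 (1 + y) 2 by
        rw [← sub_nonneg]
        simp only [etaDeltaRe, Nat.reduceAdd, etaCoeffRe_one, etaCoeffRe_two, etaCoeffRe_three,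
          etaCoeffRe_four]
        ring_nf
        positivity)
    have h3 := neg_mul_le_sigma_one_mul (Nat.sub_le (16 + t + 1 + 1) 3)
      (show 0 ≤ 17 / 72 * y ^ 2 + 25 / 16 * y ^ 3 + 109 / 144 * y ^ 4 + 5 / 48 * y ^ 5 +
        y ^ 6 / 144 by positivity)
      (show -(17 / 72 * y ^ 2 + 25 / 16 * y ^ 3 + 109 / 144 * y ^ 4 + 5 / 48 * y ^ 5 +
          y ^ 6 / 144) ≤
          etaDeltaRe 3 (1 + y) 3 by
        rw [← sub_nonneg]
        simp only [etaDeltaRe, Nat.reduceAdd, etaCoeffRe_two, etaCoeffRe_three, etaCoeffRe_four]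
        ring_nf
        positivity)
    have hsum := mul_le_mul_of_nonneg_left
      (add_le_add (add_le_add (add_le_add h0 h1) h2) h3) (show 0 ≤ 1 + y by positivity)
    rw [zero_add]
    refine lt_of_lt_of_le ?_ (add_le_add_right hsum _)
    rw [etaCoeffRe_four]
    push_cast
    ring_nf
    positivity

/-- The value `Δ_{a,b}(x)` at a real point `x` is real and positive. -/
theorem mainTheorem1 (a b : ℕ) (hb : b = 1 ∨ b = 2 ∨ b = 3) (ha : b + 2 ≤ a)
    (x : ℝ) (hx : (if Odd b then (1 : ℝ) else 2) < x) :
    (etaDelta a b (x : ℂ)).im = 0 ∧ 0 < (etaDelta a b (x : ℂ)).re := by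
  have ha1 : 1 ≤ a := by omega
  rw [← ofReal_etaDeltaRe ha1, Complex.ofReal_im, Complex.ofReal_re]
  refine ⟨rfl, ?_⟩
  rcases hb with rfl | rfl | rfl
  · exact etaDeltaRe_one_pos (by rwa [if_pos (by decide)] at hx) ha
  · exact etaDeltaRe_two_pos (by rwa [if_neg (by decide)] at hx) ha
  · exact etaDeltaRe_three_pos (by rwa [if_pos (by decide)] at hx) ha
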